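/- Let $G=(V,E)$ be a finite simple graph and $\omega$ an acyclic orientation of $G$. Let $[\omega]$ be the class of $\omega$ under the equivalence relation on acyclic orientations of $G$ generated by converting a source vertex into a sink. For an acyclic orientation $\omega'$, let $P(G,\omega')$ be the poset on $V$ in which $i\le j$ iff there is a directed path from $i$ to $j$ in $\omega'$, and let $$\mathcal O(P(G,\omega'))=\{x\in[0,1]^V : x_i\le x_j \text{ whenever } i\le j \text{ in } P(G,\omega')\}$$ be its order polytope. Let $P=P(G,[\omega])$ be the toric poset of $(G,[\omega])$. Its chamber $c(P)$ is the connected component of $\{x\in\mathbb R^V/\mathbb Z^V : x_i\ne x_j \text{ for all } \{i,j\}\in E\}$ whose points induce exactly the orientations in $[\omega]$; here a point $x$ directs the edge $\{i,j\}$ as $i\to j$ iff $x_i \bmod 1<x_j \bmod 1$, with representatives in $[0,1)$. For a partition $\pi$ of $V$ let $D_\pi^{\rm tor}$ be the set of $x\in\mathbb R^V/\mathbb Z^V$ with $x_i=x_j$ whenever $i,j$ lie in the same block of $\pi$. Let $\mathrm{cl}_P^{\rm tor}(\pi)$ be the join, in the lattice of partitions ordered by refinement, of all coarsenings $\pi'$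 of $\pi$ with $\overline{c(P)}\cap D^{\rm tor}_{\pi'}=\overline{c(P)}\cap D^{\rm tor}_{\pi}$. The partition $\pi$ is closed with respect to $P$ if $\mathrm{cl}_P^{\rm tor}(\pi)=\pi$. A subset $J\subseteq V$ is a toric filter of $P$ if the partition $\{J,V\setminus J\}$ of $V$ (with the empty part omitted if $J=\varnothing$ or $J=V$) is closed with respect to $P$. For $I\subseteq V$ let $\chi_I\in\{0,1\}^V\subseteq\mathbb R^V$ be the function with value $1$ on $I$ and $0$ off $I$. Then, for every $I\subseteq V$, $\chi_I$ is the characteristic function of a toric filter of $P(G,[\omega])$ if and only if $\chi_I$ is a vertex of the order polytope $\mathcal O(P(G,\omega'))$ for some $\omega'\in[\omega]$. -/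

import Mathlib

namespace Toric

/-- An acyclic orientation `ω` of the simple graph `G`: `ω.arrow i j` says that the edge `{i, j}`
is directed `i → j`.  Each edge gets at least one direction, and not both because there are no
directed cycles. -/
@[ext]
structure AcyclicOrientation {V : Type*} (G : SimpleGraph V) where
  arrow : V → V → Prop
  adj_iff : ∀ i j, G.Adj i j ↔ arrow i j ∨ arrow j i
  acyclic : ∀ i, ¬ Relation.TransGen arrow i i

/-- The poset `P(G, ω)`: `i ≤ j` iff there is a directed path (possibly of length `0`)
from `i` to `j` in `ω`. -/
@[reducible]
def AcyclicOrientation.poset {V : Type*} {G : SimpleGraph V} (ω : AcyclicOrientation G) :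
    PartialOrder V where
  le i j := Relation.ReflTransGen ω.arrow i j
  le_refl _ := Relation.ReflTransGen.refl
  le_trans _ _ _ h h' := h.trans h'
  le_antisymm i j h h' := by
    rcases Relation.reflTransGen_iff_eq_or_transGen.1 h with e | t
    · exact e.symm
    · exact absurd (t.trans_left h') (ω.acyclic i)

/-- `ω'` is obtained from `ω` by converting a source `v` into a sink, that is, by reversing all
edges at `v`. -/
def IsFlip {V : Type*} {G : SimpleGraph V} (ω ω' : AcyclicOrientation G) : Prop :=
  ∃ v : V, (∀ i, ¬ ω.arrow i v) ∧
    ∀ i j, ω'.arrow i j ↔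
      ((i = v ∨ j = v) ∧ ω.arrow j i) ∨ (i ≠ v ∧ j ≠ v ∧ ω.arrow i j)

/-- The toric equivalence class `[ω]`: the class of `ω` under the equivalence relation generated
by source-to-sink (hence also sink-to-source) flips. -/
def toricClass {V : Type*} {G : SimpleGraph V} (ω : AcyclicOrientation G) :
    Set (AcyclicOrientation G) :=
  {ω' | Relation.EqvGen IsFlip ω ω'}

/-- The torus `ℝ^V / ℤ^V`, as the product of the circles `ℝ / ℤ`. -/
abbrev Torus (V : Type*) : Type _ := V → UnitAddCircle

/-- The representative in `[0, 1)` of a point of `ℝ / ℤ`. -/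
noncomputable def modOne (t : UnitAddCircle) : ℝ :=
  (AddCircle.equivIco (1 : ℝ) 0 t : ℝ)

theorem modOne_injective : Function.Injective modOne := fun _ _ h =>
  (AddCircle.equivIco (1 : ℝ) 0).injective (Subtype.ext h)

/-- The complement in the torus of the toric graphic arrangement of `G`, the union of the toric
hyperplanes `{x | x i = x j}` over the edges `{i, j}` of `G`. -/
def toricComplement {V : Type*} (G : SimpleGraph V) : Set (Torus V) :=
  {x | ∀ i j, G.Adj i j → x i ≠ x j}

/-- The toric chambers of `G`: the connected components of the complement of the toric graphic
arrangement. -/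
def toricChambers {V : Type*} (G : SimpleGraph V) : Set (Set (Torus V)) :=
  {c | ∃ x ∈ toricComplement G, c = connectedComponentIn (toricComplement G) x}

/-- The acyclic orientation determined by a point of the complement of the toric arrangement:
`i → j` iff `{i, j}` is an edge and `x i mod 1 < x j mod 1`. -/
noncomputable def toricOrientation {V : Type*} (G : SimpleGraph V) (x : toricComplement G) :
    AcyclicOrientation G where
  arrow i j := G.Adj i j ∧ modOne (x.1 i) < modOne (x.1 j)
  adj_iff i j := by
    constructor
    · intro h
      have hne : modOne (x.1 i) ≠ modOne (x.1 j) :=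
        fun e => x.2 i j h (modOne_injective e)
      rcases lt_or_gt_of_ne hne with l | l
      · exact Or.inl ⟨h, l⟩
      · exact Or.inr ⟨h.symm, l⟩
    · rintro (h | h)
      · exact h.1
      · exact h.1.symm
  acyclic i h := by
    have key : ∀ a b, Relation.TransGen
        (fun i j => G.Adj i j ∧ modOne (x.1 i) < modOne (x.1 j)) a b →
        modOne (x.1 a) < modOne (x.1 b) := by
      intro a b hab
      induction hab with
      | single h => exact h.2
      | tail _ h ih => exact ih.trans h.2
    exact lt_irrefl _ (key i i h)

/-- The toric poset `P(G, [ω])`, given as a subset of the torus: it is the toric chamber `c` of `G`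
(there is exactly one) whose points induce exactly the orientations in `[ω]`. -/
def toricPoset {V : Type*} (G : SimpleGraph V) (ω : AcyclicOrientation G) : Set (Torus V) :=
  ⋃₀ {c | c ∈ toricChambers G ∧
    toricOrientation G '' {x : toricComplement G | (x : Torus V) ∈ c} = toricClass ω}

/-- The set `D_π` of points of the torus whose coordinates agree on each block of the
partition `π`. -/
def toricFlat {V : Type*} (π : Setoid V) : Set (Torus V) :=
  {x | ∀ i j, π i j → x i = x j}

/-- The closure of the partition `π` with respect to the toric poset with chamber `c`: the join, in
the lattice of partitions ordered by refinement (finer is smaller), of all coarsenings `π'` of `π`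
with `closure c ∩ D_π' = closure c ∩ D_π`. -/
def toricPartitionClosure {V : Type*} (c : Set (Torus V)) (π : Setoid V) : Setoid V :=
  sSup {π' | π ≤ π' ∧ closure c ∩ toricFlat π' = closure c ∩ toricFlat π}

/-- The partition `{I, V \ I}` of `V` (with one block, if `I` or its complement is empty). -/
def twoBlockPartition {V : Type*} (I : Set V) : Setoid V where
  r i j := i ∈ I ↔ j ∈ I
  iseqv := ⟨fun _ => Iff.rfl, fun h => h.symm, fun h h' => h.trans h'⟩

/-- `I` is a toric filter of the toric poset with chamber `c`: the partition `{I, V \ I}` is closed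
with respect to it. -/
def IsToricFilter {V : Type*} (c : Set (Torus V)) (I : Set V) : Prop :=
  toricPartitionClosure c (twoBlockPartition I) = twoBlockPartition I

/-- The order polytope of a poset `P` on `V`. -/
def orderPolytope {V : Type*} (P : PartialOrder V) : Set (V → ℝ) :=
  {x | (∀ i, x i ∈ Set.Icc (0 : ℝ) 1) ∧ ∀ i j, P.le i j → x i ≤ x j}

/-- The characteristic function of `I`, a point of `ℝ^V`. -/
noncomputable def charFun {V : Type*} (I : Set V) : V → ℝ :=
  I.indicator (fun _ => 1)

end Toric

/-! A 0/1 point is extreme in the order polytope as soon as it lies in it, so the vertices `charFun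
I` are the indicators of up-sets. The claim becomes: `I` is a toric filter iff no arrow of some
orientation in the class leaves `I`.

If `I` is a proper nonempty filter, the closed chamber contains a point with one value on `I` and
another off `I`; otherwise the one-block partition would cut out the same set. A diagonal
translation puts these values on either side of 1/2, larger on `I`, and nearby chamber points then
induce orientations with no arrow leaving `I`. Conversely, for an up-set `I` of `ω'` and a linear
extension `f`, the points `ε f + χ_I / 2` induce `ω'` and tend to `χ_I / 2`. This limit separates
`I` from its complement, so no coarser partition gives the same intersection.

Both directions use that the orientations induced on a chamber form exactly one toric class
(`image_component_eq_toricClass`). Flips are realized by moving one coordinate through 0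
(`exists_isFlip_in_component`); conversely, the class is locally constant
(`eventually_eqvGen_isFlip`). -/

namespace Toric

open Set Filter Topology

variable {V : Type*} {G : SimpleGraph V}

/-! ### Acyclic orientations and source-to-sink flips -/

namespace AcyclicOrientation

theorem arrow_asymm (ω : AcyclicOrientation G) {i j : V} (h : ω.arrow i j) : ¬ ω.arrow j i :=
  fun h' => ω.acyclic i (.tail (.single h) h')

theorem ne_of_arrow (ω : AcyclicOrientation G) {i j : V} (h : ω.arrow i j) : i ≠ j := by
  rintro rfl
  exact ω.arrow_asymm h h

theorem adj_of_arrow (ω : AcyclicOrientation G) {i j : V} (h : ω.arrow i j) : G.Adj i j :=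
  (ω.adj_iff i j).2 (Or.inl h)

theorem eq_of_arrow_imp {ω ω' : AcyclicOrientation G}
    (h : ∀ i j, ω.arrow i j → ω'.arrow i j) : ω = ω' := by
  ext i j
  refine ⟨h i j, fun h' => ?_⟩
  rcases (ω.adj_iff i j).1 (ω'.adj_of_arrow h') with h₁ | h₁
  · exact h₁
  · exact absurd (h _ _ h₁) (ω'.arrow_asymm h')

/-- The orientation obtained by converting the source `v` into a sink. -/
def flip (ω : AcyclicOrientation G) (v : V) (hv : ∀ i, ¬ ω.arrow i v) : AcyclicOrientation G where
  arrow i j := ((i = v ∨ j = v) ∧ ω.arrow j i) ∨ (i ≠ v ∧ j ≠ v ∧ ω.arrow i j)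
  adj_iff i j := by
    rw [ω.adj_iff]
    tauto
  acyclic i h := by
    -- After the flip `v` is a sink, so a path can meet `v` only at its end.
    have key : ∀ a b, Relation.TransGen (fun i j =>
        ((i = v ∨ j = v) ∧ ω.arrow j i) ∨ (i ≠ v ∧ j ≠ v ∧ ω.arrow i j)) a b →
        a ≠ v ∧ (b = v ∨ Relation.TransGen ω.arrow a b) := by
      intro a b hab
      have step : ∀ c d, (((c = v ∨ d = v) ∧ ω.arrow d c) ∨ (c ≠ v ∧ d ≠ v ∧ ω.arrow c d)) →
          c ≠ v ∧ (d = v ∨ ω.arrow c d) := by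
        rintro c d (⟨rfl | rfl, hdc⟩ | ⟨h₁, -, h₂⟩)
        · exact absurd hdc (hv d)
        · exact ⟨(ω.ne_of_arrow hdc).symm, Or.inl rfl⟩
        · exact ⟨h₁, Or.inr h₂⟩
      induction hab with
      | single h => exact ⟨(step _ _ h).1, (step _ _ h).2.imp_right .single⟩
      | tail _ h ih =>
        obtain ⟨h₁, h₂⟩ := step _ _ h
        exact ⟨ih.1, h₂.imp_right fun h₃ => (ih.2.resolve_left h₁).tail h₃⟩
    obtain ⟨h₁, h₂⟩ := key i i h
    exact ω.acyclic i (h₂.resolve_left h₁)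

theorem isFlip_flip (ω : AcyclicOrientation G) (v : V) (hv : ∀ i, ¬ ω.arrow i v) :
    IsFlip ω (ω.flip v hv) :=
  ⟨v, hv, fun _ _ => Iff.rfl⟩

/-- A nonempty finite set of vertices has an element that receives no arrow from the set. -/
theorem exists_minimal [Finite V] (ω : AcyclicOrientation G) {S : Set V} (hS : S.Nonempty) :
    ∃ v ∈ S, ∀ i ∈ S, ¬ ω.arrow i v := by
  let := ω.poset
  obtain ⟨v, hv⟩ := S.toFinite.exists_minimal hS
  refine ⟨v, hv.1, fun i hi h => ?_⟩
  have hle : v ≤ i := hv.2 hi (Relation.ReflTransGen.single h)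
  exact ω.acyclic i (Relation.TransGen.head' h hle)

/-- A linear extension with values in `[0, 1)`. -/
theorem exists_rank [Finite V] (ω : AcyclicOrientation G) :
    ∃ f : V → ℝ, (∀ i, f i ∈ Ico (0 : ℝ) 1) ∧ ∀ i j, ω.arrow i j → f i < f j := by
  have := Fintype.ofFinite V
  have hN : (0 : ℝ) < Nat.card V + 1 := by positivity
  -- Count strict predecessors; the extra 1 in the denominator keeps the value below 1.
  refine ⟨fun i => ({k | Relation.TransGen ω.arrow k i} : Set V).ncard / (Nat.card V + 1),
    fun i => ⟨by positivity, ?_⟩, fun i j h => ?_⟩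
  · rw [div_lt_one hN]
    have : ({k | Relation.TransGen ω.arrow k i} : Set V).ncard ≤ Nat.card V := by
      rw [← Set.ncard_univ]
      exact Set.ncard_le_ncard (subset_univ _)
    exact_mod_cast Nat.lt_succ_of_le this
  · refine (div_lt_div_iff_of_pos_right hN).2 (Nat.cast_lt.2 (Set.ncard_lt_ncard ?_))
    refine ⟨fun k hk => Relation.TransGen.tail hk h, fun hsub => ?_⟩
    exact ω.acyclic i (hsub (Relation.TransGen.single h))

end AcyclicOrientation

/-- Reversing all edges between a set `S` that receives no arrows and its complement does not
change the toric equivalence class. -/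
theorem eqvGen_isFlip_of_reverse_cut [Finite V] :
    ∀ (n : ℕ) (S : Set V) (ω ω' : AcyclicOrientation G), S.ncard = n →
      (∀ i j, i ∉ S → j ∈ S → ¬ ω.arrow i j) →
      (∀ i j, ω.arrow i j → (i ∈ S ∧ j ∉ S → ω'.arrow j i) ∧ ((i ∈ S ↔ j ∈ S) → ω'.arrow i j)) →
      Relation.EqvGen IsFlip ω ω' := by
  intro n
  induction n with
  | zero =>
    intro S ω ω' hS _ h
    rw [Set.ncard_eq_zero] at hS
    subst hS
    rw [AcyclicOrientation.eq_of_arrow_imp fun i j hij => (h i j hij).2 (by simp)]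
    exact .refl _
  | succ n ih =>
    intro S ω ω' hS hin h
    have hne : S.Nonempty := by
      rw [← Set.ncard_pos, hS]
      exact n.succ_pos
    obtain ⟨v, hvS, hv⟩ := ω.exists_minimal hne
    have hsrc : ∀ i, ¬ ω.arrow i v := by
      intro i hi
      by_cases hiS : i ∈ S
      · exact hv i hiS hi
      · exact hin i v hiS hvS hi
    -- Once flipped, `v` is a sink, so `S \ {v}` still receives no arrows. Edges between `v` and the
    -- rest of `S` are reversed now and restored by the later flips.
    refine .trans _ _ _ (.rel _ _ (ω.isFlip_flip v hsrc)) (ih (S \ {v}) _ ω' ?_ ?_ ?_)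
    · rw [Set.ncard_sdiff_singleton_of_mem hvS, hS, Nat.add_sub_cancel]
    · rintro i j hi ⟨hjS, hjv⟩ (⟨rfl | rfl, hij⟩ | ⟨hiv, -, hij⟩)
      · exact hsrc j hij
      · exact hjv rfl
      · exact hin i j (fun hiS => hi ⟨hiS, hiv⟩) hjS hij
    · rintro i j (⟨rfl | rfl, hij⟩ | ⟨hiv, hjv, hij⟩)
      · exact absurd hij (hsrc j)
      · have := h _ _ hij
        have hne := ω.ne_of_arrow hij
        simp only [Set.mem_sdiff, mem_singleton_iff, hne.symm, not_false_eq_true, and_true, not_true,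
          and_false]
        tauto
      · have := h _ _ hij
        simp only [Set.mem_sdiff, mem_singleton_iff, hiv, hjv, not_false_eq_true, and_true]
        exact this

/-! ### Representatives in [0, 1) -/

theorem modOne_mem (t : UnitAddCircle) : modOne t ∈ Ico (0 : ℝ) 1 := by
  have h := (AddCircle.equivIco (1 : ℝ) 0 t).2
  exact ⟨h.1, h.2.trans_eq (zero_add 1)⟩

theorem coe_modOne (t : UnitAddCircle) : ((modOne t : ℝ) : UnitAddCircle) = t :=
  AddCircle.coe_equivIco

theorem modOne_coe {r : ℝ} (hr : r ∈ Ico (0 : ℝ) 1) : modOne (r : UnitAddCircle) = r := by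
  rw [modOne, AddCircle.equivIco_coe_eq (by rwa [zero_add])]

theorem modOne_coe_of_neg {r : ℝ} (hr : r ∈ Ico (-1 : ℝ) 0) :
    modOne (r : UnitAddCircle) = r + 1 := by
  rw [← AddCircle.coe_add_period (1 : ℝ) r]
  exact modOne_coe ⟨by linarith [hr.1], by linarith [hr.2]⟩

theorem modOne_eq_zero {t : UnitAddCircle} : modOne t = 0 ↔ t = 0 := by
  rw [← modOne_coe (r := 0) (by simp), modOne_injective.eq_iff, AddCircle.coe_zero]

theorem continuousAt_modOne {t : UnitAddCircle} (ht : t ≠ 0) : ContinuousAt modOne t :=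
  continuous_subtype_val.continuousAt.comp (AddCircle.continuousAt_equivIco 1 0 (by simpa using ht))

theorem eventually_modOne_near_zero {ε : ℝ} (hε : 0 < ε) (hε₁ : ε ≤ 1) :
    ∀ᶠ t in 𝓝 (0 : UnitAddCircle), modOne t < ε ∨ 1 - ε < modOne t := by
  have hmem : ((↑) : ℝ → UnitAddCircle) '' Ioo (-ε) ε ∈ 𝓝 ((0 : ℝ) : UnitAddCircle) :=
    QuotientAddGroup.isOpenMap_coe.image_mem_nhds (Ioo_mem_nhds (by linarith) hε)
  rw [AddCircle.coe_zero] at hmem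
  filter_upwards [hmem]
  rintro _ ⟨r, hr, rfl⟩
  rcases lt_or_ge r 0 with h | h
  · rw [modOne_coe_of_neg ⟨by linarith [hr.1], h⟩]
    exact Or.inr (by linarith [hr.1])
  · rw [modOne_coe ⟨h, by linarith [hr.2]⟩]
    exact Or.inl hr.2

theorem coe_ne_coe_of_abs_sub {a b : ℝ} (hab : a ≠ b) (h : |a - b| < 1) :
    (a : UnitAddCircle) ≠ b := by
  intro e
  rw [← sub_eq_zero, ← AddCircle.coe_sub, AddCircle.coe_eq_zero_iff] at e
  obtain ⟨n, hn⟩ := e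
  rw [zsmul_one] at hn
  rw [← hn, ← Int.cast_abs, ← Int.cast_one, Int.cast_lt, Int.abs_lt_one_iff] at h
  rw [h, Int.cast_zero] at hn
  exact hab (sub_eq_zero.1 hn.symm)

/-! ### Toric chambers and toric equivalence classes -/

theorem toricOrientation_eq {x : toricComplement G} {ω : AcyclicOrientation G}
    (h : ∀ i j, ω.arrow i j → modOne (x.1 i) < modOne (x.1 j)) : toricOrientation G x = ω :=
  (AcyclicOrientation.eq_of_arrow_imp (ω' := toricOrientation G x)
    fun i j hij => ⟨ω.adj_of_arrow hij, h i j hij⟩).symm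

theorem mem_toricComplement_of_arrow {x : Torus V} (ω : AcyclicOrientation G)
    (h : ∀ i j, ω.arrow i j → modOne (x i) < modOne (x j)) : x ∈ toricComplement G := by
  intro i j hij e
  rcases (ω.adj_iff i j).1 hij with h' | h'
  · exact (h _ _ h').ne (congrArg _ e)
  · exact (h _ _ h').ne (congrArg _ e.symm)

/-- A continuous motion inside the complement of the toric arrangement stays in a component. -/
theorem mem_connectedComponentIn_of_path {γ : ℝ → Torus V} (hγ : Continuous γ)
    (h : ∀ s ∈ Icc (0 : ℝ) 1, γ s ∈ toricComplement G) :
    γ 1 ∈ connectedComponentIn (toricComplement G) (γ 0) :=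
  ((isPreconnected_Icc (a := (0 : ℝ)) (b := 1)).image γ
    hγ.continuousOn).subset_connectedComponentIn
    (mem_image_of_mem γ (by simp)) (by rintro _ ⟨s, hs, rfl⟩; exact h s hs)
    (mem_image_of_mem γ (by simp))

theorem mem_connectedComponentIn_of_toricOrientation_eq {x y : toricComplement G}
    (h : toricOrientation G x = toricOrientation G y) :
    y.1 ∈ connectedComponentIn (toricComplement G) x.1 := by
  -- Interpolating the representatives linearly preserves every strict inequality along an arrow.
  let γ : ℝ → Torus V := fun s i => (((1 - s) * modOne (x.1 i) + s * modOne (y.1 i) : ℝ) :)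
  have h0 : γ 0 = x.1 := by
    ext i
    simp [γ, coe_modOne]
  have h1 : γ 1 = y.1 := by
    ext i
    simp [γ, coe_modOne]
  have hγ : Continuous γ := continuous_pi fun i =>
    (AddCircle.continuous_mk' 1).comp (by fun_prop)
  rw [← h0, ← h1]
  refine mem_connectedComponentIn_of_path hγ fun s hs =>
    mem_toricComplement_of_arrow (toricOrientation G x) fun i j hij => ?_
  have hmod : ∀ i, modOne (γ s i) = (1 - s) * modOne (x.1 i) + s * modOne (y.1 i) := fun i =>
    modOne_coe ((convex_Ico (0 : ℝ) 1) (modOne_mem _) (modOne_mem _) (by linarith [hs.2]) hs.1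
      (by ring))
  have hx := hij.2
  rw [h] at hij
  have hy := hij.2
  rw [hmod, hmod]
  rcases hs.1.eq_or_lt with rfl | hs0
  · simpa using hx
  · have := mul_lt_mul_of_pos_left hy hs0
    have := mul_le_mul_of_nonneg_left hx.le (sub_nonneg.2 hs.2)
    linarith

theorem exists_toricOrientation_eq [Finite V] (ω : AcyclicOrientation G) :
    ∃ x : toricComplement G, toricOrientation G x = ω := by
  obtain ⟨f, hf, hlt⟩ := ω.exists_rank
  have h : ∀ i j, ω.arrow i j → modOne (f i : UnitAddCircle) < modOne (f j : UnitAddCircle) :=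
    fun i j hij => by
      rw [modOne_coe (hf i), modOne_coe (hf j)]
      exact hlt i j hij
  exact ⟨⟨fun i => (f i : UnitAddCircle), mem_toricComplement_of_arrow ω h⟩,
    toricOrientation_eq h⟩

/-- The coordinate of the source `v` slides down through 0 to `M - 1`, reappearing as `M`, above all
others. Its neighbours have values above its starting point and below `M`, so it meets none of them.
-/
theorem exists_isFlip_in_component [Finite V] {x : toricComplement G} {ω' : AcyclicOrientation G}
    (h : IsFlip (toricOrientation G x) ω') :
    ∃ y : toricComplement G, y.1 ∈ connectedComponentIn (toricComplement G) x.1 ∧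
      toricOrientation G y = ω' := by
  classical
  obtain ⟨v, hv, hω'⟩ := h
  obtain ⟨M, hM1, hM⟩ : ∃ M < (1 : ℝ), ∀ i, modOne (x.1 i) < M := by
    have : ∀ᶠ M in 𝓝[<] (1 : ℝ), ∀ i, modOne (x.1 i) < M :=
      eventually_all.2 fun i =>
        eventually_nhdsWithin_of_eventually_nhds (lt_mem_nhds (modOne_mem _).2)
    obtain ⟨M, h₁, h₂⟩ := (this.and self_mem_nhdsWithin).exists
    exact ⟨M, h₂, h₁⟩
  have hv0 := (modOne_mem (x.1 v)).1
  have hvM := hM v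
  let g : ℝ → V → ℝ := fun s =>
    Function.update (fun i => modOne (x.1 i)) v ((1 - s) * modOne (x.1 v) + s * (M - 1))
  let γ : ℝ → Torus V := fun s i => (g s i : UnitAddCircle)
  have gv : ∀ s, g s v = (1 - s) * modOne (x.1 v) + s * (M - 1) := fun s => by simp [g]
  have gne : ∀ s i, i ≠ v → g s i = modOne (x.1 i) := fun s i hi => by simp [g, hi]
  have h0 : γ 0 = x.1 := by
    ext i
    by_cases hi : i = v
    · subst hi
      simp [γ, gv, coe_modOne]
    · simp [γ, gne _ _ hi, coe_modOne]
  have hγ : Continuous γ := continuous_pi fun i => (AddCircle.continuous_mk' 1).comp <| by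
    by_cases hi : i = v
    · subst hi
      simp only [gv]
      fun_prop
    · simp only [gne _ _ hi]
      fun_prop
  have hvne : ∀ s ∈ Icc (0 : ℝ) 1, ∀ j, G.Adj v j → γ s v ≠ γ s j := by
    intro s hs j hj
    have hlt : modOne (x.1 v) < modOne (x.1 j) := by
      rcases ((toricOrientation G x).adj_iff v j).1 hj with h' | h'
      · exact h'.2
      · exact absurd h' (hv j)
    have hjM := hM j
    have e₁ : g s v ≤ modOne (x.1 v) := by
      rw [gv]
      nlinarith [hs.1, hs.2]
    have e₂ : M - 1 ≤ g s v := by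
      rw [gv]
      nlinarith [hs.1, hs.2]
    have e₃ := gne s j hj.ne'
    refine coe_ne_coe_of_abs_sub (by linarith) (abs_lt.2 ⟨by linarith, ?_⟩)
    linarith
  have hmem : ∀ s ∈ Icc (0 : ℝ) 1, γ s ∈ toricComplement G := by
    intro s hs i j hij
    by_cases hi : i = v
    · subst hi
      exact hvne s hs j hij
    by_cases hj : j = v
    · subst hj
      exact (hvne s hs i hij.symm).symm
    have := x.2 i j hij
    simpa [γ, gne _ _ hi, gne _ _ hj, coe_modOne] using this
  refine ⟨⟨γ 1, hmem 1 (by simp)⟩, h0 ▸ mem_connectedComponentIn_of_path hγ hmem,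
    toricOrientation_eq fun i j hij => ?_⟩
  have mv : modOne (γ 1 v) = M := by
    have : g 1 v = M - 1 := by simp [gv]
    simp only [γ, this]
    rw [modOne_coe_of_neg ⟨by linarith, by linarith⟩]
    ring
  have mne : ∀ i, i ≠ v → modOne (γ 1 i) = modOne (x.1 i) := fun i hi => by
    simp only [γ, gne 1 i hi, coe_modOne]
  rcases (hω' i j).1 hij with ⟨rfl | rfl, h⟩ | ⟨hi, hj, h⟩
  · exact absurd h (hv j)
  · rw [mv, mne _ ((toricOrientation G x).ne_of_arrow h).symm]
    exact hM i
  · rw [mne i hi, mne j hj]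
    exact h.2

/-- `modOne` jumps only at 0, so near `x` an edge can be reversed only when its tail has coordinate
0 at `x` and wraps to just below 1. The wrapped vertices receive no arrows, so the reversal is a cut
reversal, hence a sequence of flips. -/
theorem eventually_eqvGen_isFlip [Finite V] (x : toricComplement G) :
    ∀ᶠ y in 𝓝 x.1, ∀ hy : y ∈ toricComplement G,
      Relation.EqvGen IsFlip (toricOrientation G x) (toricOrientation G ⟨y, hy⟩) := by
  have hev : ∀ i j, (toricOrientation G x).arrow i j → ∀ᶠ y in 𝓝 x.1,
      (x.1 i ≠ 0 → modOne (y i) < modOne (y j)) ∧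
      (x.1 i = 0 → (modOne (y i) ≤ 1 / 2 ∧ modOne (y i) < modOne (y j)) ∨
        (1 / 2 < modOne (y i) ∧ modOne (y j) < modOne (y i))) := by
    intro i j hij
    have hj : x.1 j ≠ 0 := fun e => by
      have := hij.2
      rw [modOne_eq_zero.2 e] at this
      exact absurd this (modOne_mem _).1.not_gt
    have cj : ContinuousAt (fun y : Torus V => modOne (y j)) x.1 :=
      (continuousAt_modOne hj).comp (f := fun y : Torus V => y j) (continuous_apply j).continuousAt
    by_cases hi : x.1 i = 0
    -- With this `ε`, a value within `ε` of 0 or of 1 stays clear of both `modOne (x.1 j)` and 1/2.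
    · obtain ⟨ε, hε, hε'⟩ : ∃ ε > 0, ε < min (1 / 2) (min (modOne (x.1 j)) (1 - modOne (x.1 j))) :=
        exists_between (by
          have := hij.2
          rw [modOne_eq_zero.2 hi] at this
          simp [this, (modOne_mem (x.1 j)).2])
      simp only [lt_min_iff] at hε'
      obtain ⟨h₁, h₂, h₃⟩ := hε'
      have ci : ∀ᶠ y in 𝓝 x.1, modOne (y i) < ε ∨ 1 - ε < modOne (y i) := by
        have ht : Tendsto (fun y : Torus V => y i) (𝓝 x.1) (𝓝 0) :=
          hi ▸ (continuous_apply i).continuousAt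
        exact ht.eventually (eventually_modOne_near_zero hε (by linarith))
      filter_upwards [ci, cj.eventually_const_lt h₂,
        cj.eventually_lt_const (show modOne (x.1 j) < 1 - ε by linarith)] with y a b c
      refine ⟨fun h => absurd hi h, fun _ => a.imp (fun a => ⟨?_, ?_⟩) fun a => ⟨?_, ?_⟩⟩ <;>
        linarith
    · have ci : ContinuousAt (fun y : Torus V => modOne (y i)) x.1 :=
        (continuousAt_modOne hi).comp (f := fun y : Torus V => y i)
          (continuous_apply i).continuousAt
      filter_upwards [ci.eventually_lt cj hij.2] with y hy
      exact ⟨fun _ => hy, fun h => absurd h hi⟩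
  have hall : ∀ᶠ y in 𝓝 x.1, ∀ i j, (toricOrientation G x).arrow i j →
      (x.1 i ≠ 0 → modOne (y i) < modOne (y j)) ∧
      (x.1 i = 0 → (modOne (y i) ≤ 1 / 2 ∧ modOne (y i) < modOne (y j)) ∨
        (1 / 2 < modOne (y i) ∧ modOne (y j) < modOne (y i))) := by
    refine eventually_all.2 fun i => eventually_all.2 fun j => ?_
    by_cases hij : (toricOrientation G x).arrow i j
    · filter_upwards [hev i j hij] with y hy _ using hy
    · exact Eventually.of_forall fun y h => absurd h hij
  filter_upwards [hall] with y hy hyc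
  have hj0 : ∀ i j, (toricOrientation G x).arrow i j → x.1 j ≠ 0 := fun i j hij e => by
    have := hij.2
    rw [modOne_eq_zero.2 e] at this
    exact absurd this (modOne_mem _).1.not_gt
  refine eqvGen_isFlip_of_reverse_cut _ {i | x.1 i = 0 ∧ 1 / 2 < modOne (y i)} _ _ rfl
    (fun i j _ hj hij => hj0 i j hij hj.1) fun i j hij => ⟨fun h => ⟨hij.1.symm, ?_⟩,
      fun h => ⟨hij.1, ?_⟩⟩
  · rcases (hy i j hij).2 h.1.1 with h' | h'
    · exact absurd h.1.2 h'.1.not_gt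
    · exact h'.2
  · have hi : ¬ (x.1 i = 0 ∧ 1 / 2 < modOne (y i)) := fun hi => hj0 i j hij (h.1 hi).1
    by_cases hi0 : x.1 i = 0
    · rcases (hy i j hij).2 hi0 with h' | h'
      · exact h'.2
      · exact absurd ⟨hi0, h'.1⟩ hi
    · exact (hy i j hij).1 hi0

/-- The orientations induced by the points of one chamber are torically equivalent. -/
theorem eqvGen_isFlip_of_mem_component [Finite V] {x y : toricComplement G}
    (h : y.1 ∈ connectedComponentIn (toricComplement G) x.1) :
    Relation.EqvGen IsFlip (toricOrientation G x) (toricOrientation G y) := by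
  have := isPreconnected_connectedComponentIn.induction₂
    (s := connectedComponentIn (toricComplement G) x.1)
    (fun a b => ∀ (ha : a ∈ toricComplement G) (hb : b ∈ toricComplement G),
      Relation.EqvGen IsFlip (toricOrientation G ⟨a, ha⟩) (toricOrientation G ⟨b, hb⟩))
    (fun a ha => by
      have hac := connectedComponentIn_subset _ _ ha
      filter_upwards [mem_nhdsWithin_of_mem_nhds (eventually_eqvGen_isFlip ⟨a, hac⟩)] with b hb _
      exact hb)
    (fun a b c _ hb _ hab hbc ha hc =>
      have hbF := connectedComponentIn_subset _ _ hb
      (hab ha hbF).trans _ _ _ (hbc hbF hc))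
    (fun a b _ _ hab hb ha => (hab ha hb).symm)
    (mem_connectedComponentIn x.2) h
  exact this x.2 y.2

theorem exists_mem_component_of_eqvGen [Finite V] {ω₁ ω₂ : AcyclicOrientation G}
    (h : Relation.EqvGen IsFlip ω₁ ω₂) (x : toricComplement G) :
    (∃ y : toricComplement G, y.1 ∈ connectedComponentIn (toricComplement G) x.1 ∧
      toricOrientation G y = ω₁) ↔
    ∃ y : toricComplement G, y.1 ∈ connectedComponentIn (toricComplement G) x.1 ∧
      toricOrientation G y = ω₂ := by
  induction h with
  | rel ω₁ ω₂ hflip =>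
    constructor
    · rintro ⟨y, hy, rfl⟩
      obtain ⟨z, hz, rfl⟩ := exists_isFlip_in_component hflip
      exact ⟨z, connectedComponentIn_eq hy ▸ hz, rfl⟩
    -- To undo a flip, realize `ω₁` anywhere and flip it; the result induces the same orientation as
    -- `y`, hence lies in the same component.
    · rintro ⟨y, hy, rfl⟩
      obtain ⟨z, rfl⟩ := exists_toricOrientation_eq ω₁
      obtain ⟨w, hw, hwy⟩ := exists_isFlip_in_component hflip
      have hyw := mem_connectedComponentIn_of_toricOrientation_eq hwy
      refine ⟨z, ?_, rfl⟩
      rw [connectedComponentIn_eq hy, ← connectedComponentIn_eq hyw, ← connectedComponentIn_eq hw]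
      exact mem_connectedComponentIn z.2
  | refl => exact Iff.rfl
  | symm _ _ _ ih => exact ih.symm
  | trans _ _ _ _ _ ih₁ ih₂ => exact ih₁.trans ih₂

/-- The orientations induced by the points of a chamber form a toric equivalence class. -/
theorem image_component_eq_toricClass [Finite V] (x : toricComplement G) :
    toricOrientation G '' {y : toricComplement G |
      (y : Torus V) ∈ connectedComponentIn (toricComplement G) x.1} =
      toricClass (toricOrientation G x) := by
  ext ω'
  constructor
  · rintro ⟨y, hy, rfl⟩
    exact eqvGen_isFlip_of_mem_component hy
  · intro h
    exact (exists_mem_component_of_eqvGen h x).1 ⟨x, mem_connectedComponentIn x.2, rfl⟩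

theorem toricClass_eq {ω ω' : AcyclicOrientation G} (h : ω' ∈ toricClass ω) :
    toricClass ω' = toricClass ω := by
  ext ω''
  exact ⟨fun h' => .trans _ _ _ h h', fun h' => .trans _ _ _ (.symm _ _ h) h'⟩

theorem mem_toricPoset [Finite V] {ω : AcyclicOrientation G} (x : toricComplement G)
    (hx : toricOrientation G x ∈ toricClass ω) : x.1 ∈ toricPoset G ω :=
  ⟨_, ⟨⟨x.1, x.2, rfl⟩, (image_component_eq_toricClass x).trans (toricClass_eq hx)⟩,
    mem_connectedComponentIn x.2⟩

/-- The toric poset is invariant under diagonal translations. -/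
theorem exists_translate_of_mem_toricPoset {ω : AcyclicOrientation G} {y : Torus V}
    (hy : y ∈ toricPoset G ω) (t : UnitAddCircle) :
    ∃ h : (fun i => y i + t) ∈ toricComplement G, toricOrientation G ⟨_, h⟩ ∈ toricClass ω := by
  obtain ⟨c, ⟨⟨x, hx, rfl⟩, himg⟩, hyc⟩ := hy
  have hyF := connectedComponentIn_subset _ _ hyc
  have hmem : ∀ s : UnitAddCircle, (fun i => y i + s) ∈ toricComplement G :=
    fun s i j hij e => hyF i j hij (add_right_cancel e)
  refine ⟨hmem t, ?_⟩
  rw [← himg]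
  refine mem_image_of_mem _ ?_
  have hpath := mem_connectedComponentIn_of_path
    (γ := fun s i => y i + ((s * modOne t : ℝ) : UnitAddCircle))
    (continuous_pi fun i => continuous_const.add
      ((AddCircle.continuous_mk' 1).comp (by fun_prop))) (fun s _ => hmem _)
  simp only [one_mul, coe_modOne, zero_mul, AddCircle.coe_zero, add_zero] at hpath
  rwa [← connectedComponentIn_eq hyc] at hpath

/-! ### Vertices of order polytopes and toric filters -/

theorem charFun_mem_extremePoints_iff {P : PartialOrder V} {I : Set V} :
    charFun I ∈ Set.extremePoints ℝ (orderPolytope P) ↔ ∀ i j, P.le i j → i ∈ I → j ∈ I := by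
  classical
  constructor
  · intro h i j hij hi
    by_contra hj
    have := h.1.2 i j hij
    simp only [charFun, indicator_of_mem hi, indicator_of_notMem hj] at this
    linarith
  · intro h
    refine mem_extremePoints_iff_left.2 ⟨⟨fun i => ?_, fun i j hij => ?_⟩, ?_⟩
    · by_cases hi : i ∈ I <;> simp [charFun, hi]
    · by_cases hi : i ∈ I
      · simp [charFun, hi, h i j hij hi]
      · by_cases hj : j ∈ I <;> simp [charFun, hi, hj]
    · rintro a ha b hb ⟨s, t, hs, ht, hst, e⟩
      ext i
      have ei := congrFun e i
      simp only [Pi.add_apply, Pi.smul_apply, smul_eq_mul] at ei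
      have ha' := ha.1 i
      have hb' := hb.1 i
      by_cases hi : i ∈ I
      · simp only [charFun, indicator_of_mem hi] at ei ⊢
        have : s * (1 - a i) = - (t * (1 - b i)) := by linarith
        have h₁ := mul_nonneg hs.le (sub_nonneg.2 ha'.2)
        have h₂ := mul_nonneg ht.le (sub_nonneg.2 hb'.2)
        have h₃ : s * (1 - a i) = 0 := by linarith
        rcases mul_eq_zero.1 h₃ with h₄ | h₄ <;> linarith
      · simp only [charFun, indicator_of_notMem hi] at ei ⊢
        have h₁ := mul_nonneg hs.le ha'.1
        have h₂ := mul_nonneg ht.le hb'.1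
        have h₃ : s * a i = 0 := by linarith
        rcases mul_eq_zero.1 h₃ with h₄ | h₄ <;> linarith

theorem charFun_injective : Function.Injective (charFun : Set V → V → ℝ) :=
  fun _ _ h => Set.indicator_one_inj ℝ h

/-- A toric filter is an up-set of the poset of an orientation in the class. -/
theorem IsToricFilter.exists_upperSet [Finite V] {ω : AcyclicOrientation G} {I : Set V}
    (hI : IsToricFilter (toricPoset G ω) I) :
    ∃ ω' ∈ toricClass ω, ∀ i j, ω'.arrow i j → i ∈ I → j ∈ I := by
  by_cases htriv : ∀ i j, i ∈ I → j ∈ I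
  · exact ⟨ω, .refl _, fun i j _ => htriv i j⟩
  push Not at htriv
  obtain ⟨p, q, hp, hq⟩ := htriv
  obtain ⟨x, hx, hxI, hpq⟩ : ∃ x ∈ closure (toricPoset G ω),
      (∀ i j, (i ∈ I ↔ j ∈ I) → x i = x j) ∧ x p ≠ x q := by
    by_contra! hcon
    -- Otherwise `⊤` would take part in the join defining the closure.
    have htop : (⊤ : Setoid V) ≤ twoBlockPartition I := by
      rw [← hI]
      refine le_sSup ⟨le_top, Subset.antisymm ?_ ?_⟩
      · exact fun x hx => ⟨hx.1, fun i j _ => hx.2 i j trivial⟩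
      · refine fun x hx => ⟨hx.1, ?_⟩
        have hpq := hcon x hx.1 hx.2
        have hconst : ∀ i, x i = x p := fun i => by
          by_cases hi : i ∈ I
          · exact hx.2 i p (iff_of_true hi hp)
          · exact (hx.2 i q (iff_of_false hi hq)).trans hpq.symm
        exact fun i j _ => (hconst i).trans (hconst j).symm
    have h : p ∈ I ↔ q ∈ I := htop (x := p) (y := q) trivial
    exact hq (h.1 hp)
  let d := modOne (x p - x q)
  have hd0 : 0 < d := (modOne_mem _).1.lt_of_ne fun e =>
    hpq (sub_eq_zero.1 (modOne_eq_zero.1 e.symm))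
  have hd1 : d < 1 := (modOne_mem _).2
  -- This translation places the two values symmetrically about 1/2 and away from the jump of
  -- `modOne` at 0.
  let t : UnitAddCircle := (((1 - d) / 2 : ℝ) : UnitAddCircle) - x q
  have htq : modOne (x q + t) = (1 - d) / 2 := by
    rw [add_sub_cancel, modOne_coe ⟨by linarith, by linarith⟩]
  have htp : modOne (x p + t) = (1 + d) / 2 := by
    have : x p + t = (((1 + d) / 2 : ℝ) : UnitAddCircle) := by
      have h₁ : (1 + d) / 2 = d + (1 - d) / 2 := by ring
      rw [h₁, AddCircle.coe_add, coe_modOne]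
      simp only [t]
      abel
    rw [this, modOne_coe ⟨by linarith, by linarith⟩]
  have hmod : ∀ i, modOne (x i + t) ≠ 0 ∧ (i ∈ I → 1 / 2 < modOne (x i + t)) ∧
      (i ∉ I → modOne (x i + t) < 1 / 2) := by
    intro i
    by_cases hi : i ∈ I
    · rw [hxI i p (iff_of_true hi hp), htp]
      exact ⟨by linarith, fun _ => by linarith, fun h => absurd hi h⟩
    · rw [hxI i q (iff_of_false hi hq), htq]
      exact ⟨by linarith, fun h => absurd h hi, fun _ => by linarith⟩
  have hev : ∀ᶠ y in 𝓝 x, ∀ i, (i ∈ I → 1 / 2 < modOne (y i + t)) ∧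
      (i ∉ I → modOne (y i + t) < 1 / 2) := by
    refine eventually_all.2 fun i => ?_
    obtain ⟨h0, h₁, h₂⟩ := hmod i
    have hc : ContinuousAt (fun y : Torus V => modOne (y i + t)) x :=
      (continuousAt_modOne (mt modOne_eq_zero.2 h0)).comp (f := fun y : Torus V => y i + t)
        ((continuous_apply i).add continuous_const).continuousAt
    by_cases hi : i ∈ I
    · filter_upwards [hc.eventually_const_lt (h₁ hi)] with y hy
      exact ⟨fun _ => hy, fun h => absurd hi h⟩
    · filter_upwards [hc.eventually_lt_const (h₂ hi)] with y hy
      exact ⟨fun h => absurd h hi, fun _ => hy⟩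
  obtain ⟨y, hyc, hy⟩ := ((mem_closure_iff_frequently.1 hx).and_eventually hev).exists
  obtain ⟨hmem, hcl⟩ := exists_translate_of_mem_toricPoset hyc t
  refine ⟨_, hcl, fun i j hij hi => ?_⟩
  by_contra hj
  exact lt_asymm hij.2 (((hy j).2 hj).trans ((hy i).1 hi))

/-- An up-set of the poset of an orientation in the class is a toric filter. -/
theorem isToricFilter_of_upperSet [Finite V] {ω ω' : AcyclicOrientation G} {I : Set V}
    (hω' : ω' ∈ toricClass ω) (hI : ∀ i j, ω'.arrow i j → i ∈ I → j ∈ I) :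
    IsToricFilter (toricPoset G ω) I := by
  obtain ⟨f, hf, hlt⟩ := ω'.exists_rank
  -- Halving is needed because 0 and 1 coincide on the circle.
  let g : ℝ → V → ℝ := fun ε i => ε * f i + charFun I i / 2
  let γ : ℝ → Torus V := fun ε i => (g ε i : UnitAddCircle)
  have hχ : ∀ i, (i ∈ I → charFun I i = 1) ∧ (i ∉ I → charFun I i = 0) := fun i =>
    ⟨fun hi => indicator_of_mem hi _, fun hi => indicator_of_notMem hi _⟩
  have hmod : ∀ ε ∈ Ico (0 : ℝ) (1 / 2), ∀ i, modOne (γ ε i) = g ε i := by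
    intro ε hε i
    have h₁ : 0 ≤ ε * f i := mul_nonneg hε.1 (hf i).1
    have h₂ : ε * f i ≤ ε := mul_le_of_le_one_right hε.1 (hf i).2.le
    refine modOne_coe ?_
    by_cases hi : i ∈ I
    · simp only [g, (hχ i).1 hi]
      exact ⟨by linarith, by linarith [hε.2]⟩
    · simp only [g, (hχ i).2 hi]
      exact ⟨by linarith, by linarith [hε.2]⟩
  have hγ : Continuous γ := continuous_pi fun i =>
    (AddCircle.continuous_mk' 1).comp (by fun_prop)
  have hlim : γ 0 ∈ closure (toricPoset G ω) := by
    have ht : Tendsto γ (𝓝[>] 0) (𝓝 (γ 0)) := hγ.continuousAt.tendsto.mono_left inf_le_left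
    refine mem_closure_of_tendsto ht ?_
    filter_upwards [Ioo_mem_nhdsGT (show (0 : ℝ) < 1 / 2 by norm_num)] with ε hε
    have hord : ∀ i j, ω'.arrow i j → modOne (γ ε i) < modOne (γ ε j) := by
      intro i j hij
      rw [hmod ε ⟨hε.1.le, hε.2⟩, hmod ε ⟨hε.1.le, hε.2⟩]
      have h₁ := mul_lt_mul_of_pos_left (hlt i j hij) hε.1
      have h₂ : charFun I i ≤ charFun I j := by
        by_cases hi : i ∈ I
        · rw [(hχ i).1 hi, (hχ j).1 (hI i j hij hi)]
        · rw [(hχ i).2 hi]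
          exact indicator_nonneg (fun _ _ => zero_le_one) j
      simp only [g]
      linarith
    refine mem_toricPoset ⟨γ ε, mem_toricComplement_of_arrow ω' hord⟩ ?_
    rwa [toricOrientation_eq (ω := ω') hord]
  have hblock : ∀ i j, γ 0 i = γ 0 j ↔ (i ∈ I ↔ j ∈ I) := by
    intro i j
    rw [← modOne_injective.eq_iff, hmod 0 (by norm_num), hmod 0 (by norm_num)]
    by_cases hi : i ∈ I <;> by_cases hj : j ∈ I <;> simp [g, charFun, hi, hj]
  refine le_antisymm (sSup_le ?_) (le_sSup ⟨le_rfl, rfl⟩)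
  rintro π ⟨-, hπ⟩ i j hij
  have hmem : γ 0 ∈ closure (toricPoset G ω) ∩ toricFlat π := by
    rw [hπ]
    exact ⟨hlim, fun i j h => (hblock i j).2 h⟩
  exact (hblock i j).1 (hmem.2 i j hij)

end Toric

theorem mainTheorem10 {V : Type*} [Finite V] (G : SimpleGraph V)
    (ω : Toric.AcyclicOrientation G) (I : Set V) :
    (∃ J : Set V, Toric.IsToricFilter (Toric.toricPoset G ω) J ∧
        Toric.charFun I = Toric.charFun J) ↔
      ∃ ω' ∈ Toric.toricClass ω,
        Toric.charFun I ∈ Set.extremePoints ℝ (Toric.orderPolytope ω'.poset) := by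
  simp only [Toric.charFun_mem_extremePoints_iff]
  constructor
  · rintro ⟨J, hJ, h⟩
    obtain rfl := Toric.charFun_injective h
    obtain ⟨ω', hω', hup⟩ := hJ.exists_upperSet
    refine ⟨ω', hω', fun i j hij hi => ?_⟩
    induction hij with
    | refl => exact hi
    | tail _ h ih => exact hup _ _ h ih
  · rintro ⟨ω', hω', h⟩
    exact ⟨I, Toric.isToricFilter_of_upperSet hω' fun i j hij =>
      h i j (Relation.ReflTransGen.single hij), rfl⟩
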